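/- **Quasi-semirings.** A *commutative regular quasi-semiring* (cr-qsring) is an algebra $(R,+,\bullet,-,{}^{-1},\varepsilon)$ such that: $(R,+)$ and $(R,\bullet)$ are commutative regular semigroups, with quasi-inverses $-x$ and $x^{-1}$ (that is, $x+(-x)+x=x$, $(-x)+x+(-x)=-x$, and likewise for $\bullet$ and ${}^{-1}$); $E^+\cap E^\bullet=\{\varepsilon\}$, where $E^+=\{x: x+x=x\}$ and $E^\bullet=\{x: x\bullet x=x\}$; and, writing $e^+(x)=x+(-x)$ and $x\le y$ for $x=y+e^+(x)$ (a partial order), - $x\bullet y+x\bullet z\le x\bullet(y+z)$ for all $x,y,z\in R$; - $y\le z$ implies $x\bullet y\le x\bullet z$; - $-(x\bullet y)=x\bullet(-y)$ for all $x,y\in R$; - $e^+(x+y)\le e^+(x\bullet y)$ for all $x,y\in E^\bullet$. Then $\Lambda:=E^+$ is an Abelian $l$-group with group operation $\bullet$, neutral element $\varepsilon$, order $\le$ and meet $a\wedge b=a+b$. Put $\Lambda_+=\{\alpha\in\Lambda:\alpha\ge\varepsilon\}$ and $v(x)=\varepsilon\bullet x\in\Lambda$ for $x\in R$. The cr-qsring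 $R$ is *directed* if $\varepsilon\le x$ for all $x\in E^\bullet$. A directed $R$ is *superrigid* if the injective map $E^\bullet\to\Lambda_+$, $x\mapsto e^+(x)$, is surjective; $1_\alpha$ then denotes the unique element of $E^\bullet$ with $e^+(1_\alpha)=\alpha$. **The associated ring extension.** Let $R$ be a superrigid directed cr-qsring. Let $B$ be the set of all maps $\varphi:\Lambda_+\to R$ with $e^+(\varphi(\alpha))=\alpha$ for all $\alpha\in\Lambda_+$ and $\varphi(\alpha)\le\varphi(\beta)$ whenever $\alpha\le\beta$. It is a commutative unital ring with pointwise $+$ and $-$, zero $\alpha\mapsto\alpha$, unit $\alpha\mapsto 1_\alpha$, and multiplication $$(\varphi\cdot\psi)(\alpha)=\varphi\big(\alpha\bullet v(\psi(\varepsilon))^{-1}\big)\bullet\psi\big(\alpha\bullet v(\varphi(\varepsilon))^{-1}\big)+\alpha .$$ Let $\widehat\Lambda$ be the set of all maps $\theta:\Lambda_+\to\Lambda$ with $\theta(\alpha)=\theta(\beta)\wedge\alpha$ for $\alpha\le\beta$, ordered pointwise, where $\gamma\in\Lambda$ is identified with $\alpha\mapsto\gamma\wedge\alpha$, and put $\theta_-:=\theta(\varepsilon)^{-1}\in\Lambda_+$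 for $\theta\in\widehat\Lambda$. Let $w:B\to\widehat\Lambda$, $w(\varphi)=v\circ\varphi$, and let $A=\{\varphi\in B: w(\varphi)\ge\varepsilon\}$, a subring of $B$. A commutative unital ring extension $A\subseteq B$ is *Prüfer* if every finitely generated $A$-submodule $I$ of $B$ with $IB=B$ is invertible, i.e. $IJ=A$ for some $A$-submodule $J$ of $B$. A superrigid directed cr-qsring $R$ is a *Prüfer cr-qsring* if its associated extension $A\subseteq B$ is Prüfer. **Corollary 6.7.** Let $R$ be a superrigid directed cr-qsring with associated ring extension $A\subseteq B$ and map $w$ as above. Then $R$ is a Prüfer cr-qsring if and only if for every $\varphi\in B$ there exists $\psi\in B$ such that $$\psi(\gamma^2)\le\varphi(\gamma)^{-1},\qquad\text{where }\gamma:=w(\varphi)_-=v(\varphi(\varepsilon))^{-1}\in\Lambda_+ .$$ -/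

import Mathlib

/-! ### Commutative regular quasi-semirings -/

/-- `e⁺(x) = x + (-x)`. -/
def addE {R : Type*} [AddCommSemigroup R] [Neg R] (x : R) : R := x + -x

/-- The canonical partial order of a commutative regular semigroup `(R, +)`:
`x ≤ y` iff `x = y + e⁺(x)`. -/
def AddLE {R : Type*} [AddCommSemigroup R] [Neg R] (x y : R) : Prop := x = y + addE x

/-- Commutative regular quasi-semirings `(R, +, •, -, ⁻¹, ε)`. The multiplication `•` is written
`*` and the constant `ε` is written `eps`. -/
class CrQsring (R : Type*) extends AddCommSemigroup R, CommSemigroup R, Neg R, Inv R where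
  /-- The constant `ε`. -/
  eps : R
  add_neg_add : ∀ x : R, x + -x + x = x
  neg_add_neg : ∀ x : R, -x + x + -x = -x
  mul_inv_mul : ∀ x : R, x * x⁻¹ * x = x
  inv_mul_inv : ∀ x : R, x⁻¹ * x * x⁻¹ = x⁻¹
  /-- `E⁺ ∩ E• = {ε}`, for the sets `E⁺`, `E•` of additive and multiplicative idempotents. -/
  idem_iff : ∀ x : R, (x + x = x ∧ x * x = x) ↔ x = eps
  quasidistrib : ∀ x y z : R, AddLE (x * y + x * z) (x * (y + z))
  mul_addLE_mul : ∀ x y z : R, AddLE y z → AddLE (x * y) (x * z)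
  neg_mul_eq : ∀ x y : R, -(x * y) = x * -y
  addE_add_le : ∀ x y : R, x * x = x → y * y = y → AddLE (addE (x + y)) (addE (x * y))

/-- Quasi-inverses in a commutative semigroup are unique. -/
@[to_additive]
theorem quasiInv_unique {S : Type*} [CommSemigroup S] {x y z : S} (h1 : x * y * x = x)
    (h2 : y * x * y = y) (h3 : x * z * x = x) (h4 : z * x * z = z) : y = z := by
  have a : y = z * x * y := by
    calc y = y * x * y := h2.symm
      _ = y * (x * z * x) * y := by rw [h3]
      _ = z * x * (y * x * y) := by ac_rfl
      _ = z * x * y := by rw [h2]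
  have b : z = y * x * z := by
    calc z = z * x * z := h4.symm
      _ = z * (x * y * x) * z := by rw [h1]
      _ = y * x * (z * x * z) := by ac_rfl
      _ = y * x * z := by rw [h4]
  rw [a, mul_assoc, mul_comm, mul_comm x y, ← b]

namespace CrQsring

section Basic

variable {R : Type*} [CrQsring R]

/-- `e•(x) = x • x⁻¹`. -/
def mulE (x : R) : R := x * x⁻¹

/-- `v(x) = ε • x`. -/
def val (x : R) : R := eps * x

theorem add_addE (x : R) : x + addE x = x := by
  unfold addE; rw [add_comm x (-x), ← add_assoc, add_neg_add]

theorem addE_idem (x : R) : addE x + addE x = addE x := by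
  have h := add_addE x
  calc addE x + addE x = (x + addE x) + -x := by unfold addE; ac_rfl
    _ = addE x := by rw [h]; rfl

theorem neg_of_idem {f : R} (hf : f + f = f) : -f = f :=
  quasiNeg_unique (add_neg_add f) (neg_add_neg f) (by rw [hf, hf]) (by rw [hf, hf])

theorem addE_of_idem {f : R} (hf : f + f = f) : addE f = f := by
  unfold addE; rw [neg_of_idem hf, hf]

theorem neg_add_eq (x y : R) : -(x + y) = -x + -y := by
  refine quasiNeg_unique (add_neg_add _) (neg_add_neg _) ?_ ?_
  · calc x + y + (-x + -y) + (x + y) = (x + -x + x) + (y + -y + y) := by ac_rfl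
      _ = x + y := by rw [add_neg_add, add_neg_add]
  · calc -x + -y + (x + y) + (-x + -y) = (-x + x + -x) + (-y + y + -y) := by ac_rfl
      _ = -x + -y := by rw [neg_add_neg, neg_add_neg]

theorem inv_mul_eq (x y : R) : (x * y)⁻¹ = x⁻¹ * y⁻¹ := by
  refine quasiInv_unique (mul_inv_mul _) (inv_mul_inv _) ?_ ?_
  · calc x * y * (x⁻¹ * y⁻¹) * (x * y) = (x * x⁻¹ * x) * (y * y⁻¹ * y) := by ac_rfl
      _ = x * y := by rw [mul_inv_mul, mul_inv_mul]
  · calc x⁻¹ * y⁻¹ * (x * y) * (x⁻¹ * y⁻¹) = (x⁻¹ * x * x⁻¹) * (y⁻¹ * y * y⁻¹) := by ac_rfl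
      _ = x⁻¹ * y⁻¹ := by rw [inv_mul_inv, inv_mul_inv]

theorem neg_neg_eq (x : R) : - -x = x :=
  quasiNeg_unique (add_neg_add _) (neg_add_neg _) (neg_add_neg x) (add_neg_add x)

theorem addE_neg (x : R) : addE (-x) = addE x := by
  unfold addE; rw [neg_neg_eq, add_comm]

theorem addE_add (x y : R) : addE (x + y) = addE x + addE y := by
  unfold addE; rw [neg_add_eq]; ac_rfl

theorem mul_mulE (x : R) : x * mulE x = x := by
  unfold mulE; rw [mul_comm, mul_inv_mul]

theorem mulE_idem (x : R) : mulE x * mulE x = mulE x := by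
  unfold mulE; rw [← mul_assoc, mul_inv_mul]

theorem mulE_mul (x y : R) : mulE (x * y) = mulE x * mulE y := by
  unfold mulE; rw [inv_mul_eq]; ac_rfl

/-- The canonical partial order of `(R, +)`. -/
instance instPartialOrder : PartialOrder R where
  le x y := AddLE x y
  le_refl x := (add_addE x).symm
  le_trans x y z hxy hyz := by
    have h1 : x = y + addE x := hxy
    have h2 : y = z + addE y := hyz
    have h3 : addE x = addE y + addE x := by
      nth_rewrite 1 [h1]; rw [addE_add, addE_of_idem (addE_idem x)]
    change x = z + addE x
    rw [h3, ← add_assoc, ← h2]; exact h1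
  le_antisymm x y hxy hyx := by
    have h1 : x = y + addE x := hxy
    have h2 : y = x + addE y := hyx
    have h3 : x + addE x = x := add_addE x
    calc x = y + addE x := h1
      _ = (x + addE x) + addE y := by nth_rewrite 1 [h2]; ac_rfl
      _ = y := by rw [h3, ← h2]

theorem le_def {x y : R} : x ≤ y ↔ x = y + addE x := Iff.rfl

theorem le_of_eq_add {x y f : R} (hf : f + f = f) (h : x = y + f) : x ≤ y := by
  have : addE x = addE y + f := by rw [h, addE_add, addE_of_idem hf]
  rw [le_def, this, ← add_assoc, add_addE, h]

theorem add_le_self (x : R) {f : R} (hf : f + f = f) : x + f ≤ x := le_of_eq_add hf rfl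

theorem add_le_add_right' {x y : R} (h : x ≤ y) (z : R) : x + z ≤ y + z := by
  refine le_of_eq_add (addE_idem x) ?_
  rw [add_right_comm, ← le_def.1 h]

theorem add_le_add' {x y z t : R} (h : x ≤ y) (h' : z ≤ t) : x + z ≤ y + t :=
  (add_le_add_right' h z).trans (by
    rw [add_comm y z, add_comm y t]; exact add_le_add_right' h' y)

theorem neg_le_neg' {x y : R} (h : x ≤ y) : -x ≤ -y := by
  rw [le_def, addE_neg]
  nth_rewrite 1 [le_def.1 h]
  rw [neg_add_eq, neg_of_idem (addE_idem x)]

theorem addE_mono {x y : R} (h : x ≤ y) : addE x ≤ addE y :=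
  add_le_add' h (neg_le_neg' h)

theorem eq_of_le_of_addE {x y : R} (h : x ≤ y) (h' : addE y ≤ addE x) : x = y := by
  have : addE x = addE y := le_antisymm (addE_mono h) h'
  rw [le_def.1 h, this, add_addE]

theorem mul_le_mul'' (x : R) {y z : R} (h : y ≤ z) : x * y ≤ x * z := mul_addLE_mul x y z h

theorem mul_le_mul_both {x y z t : R} (h : x ≤ y) (h' : z ≤ t) : x * z ≤ y * t :=
  (mul_le_mul'' x h').trans (by rw [mul_comm x, mul_comm y]; exact mul_le_mul'' t h)

theorem le_mul_add (x y z : R) : x * y + x * z ≤ x * (y + z) := quasidistrib x y z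

theorem mul_idem (x : R) {f : R} (hf : f + f = f) : x * f + x * f = x * f := by
  have h := le_def.1 (le_mul_add x f f)
  rw [hf, addE_add, addE_idem, add_addE] at h
  exact h

theorem add_idem_idem {f g : R} (hf : f + f = f) (hg : g + g = g) :
    (f + g) + (f + g) = f + g := by
  calc (f + g) + (f + g) = (f + f) + (g + g) := by ac_rfl
    _ = f + g := by rw [hf, hg]

theorem idem_le_add {p q r : R} (hp : p + p = p) (h : p ≤ q) (h' : p ≤ r) : p ≤ q + r := by
  rw [← hp]; exact add_le_add' h h'

theorem mul_add_idem (x : R) {f g : R} (hf : f + f = f) (hg : g + g = g) :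
    x * (f + g) = x * f + x * g := by
  refine le_antisymm ?_ (le_mul_add x f g)
  refine idem_le_add (mul_idem x (add_idem_idem hf hg)) (mul_le_mul'' x (add_le_self f hg))
    (mul_le_mul'' x ?_)
  rw [add_comm]; exact add_le_self g hf

theorem eps_add : (eps : R) + eps = eps := ((idem_iff (eps : R)).2 rfl).1

theorem eps_mul : (eps : R) * eps = eps := ((idem_iff (eps : R)).2 rfl).2

theorem mulE_of_idem {f : R} (hf : f + f = f) : mulE f = eps := by
  refine (idem_iff _).1 ⟨?_, mulE_idem f⟩
  unfold mulE; rw [mul_comm]; exact mul_idem _ hf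

theorem mul_eps_of_idem {f : R} (hf : f + f = f) : f * eps = f := by
  rw [← mulE_of_idem hf, mul_mulE]

theorem val_of_idem {f : R} (hf : f + f = f) : val f = f := by
  unfold val; rw [mul_comm, mul_eps_of_idem hf]

theorem val_idem (x : R) : val x + val x = val x := by
  unfold val; rw [mul_comm]; exact mul_idem x eps_add

theorem inv_idem {f : R} (hf : f + f = f) : f⁻¹ + f⁻¹ = f⁻¹ := by
  have : f⁻¹ * eps = f⁻¹ := by
    rw [← mulE_of_idem hf]; unfold mulE; rw [← mul_assoc, inv_mul_inv]
  rw [← this]; exact mul_idem _ eps_add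

theorem val_mul (x y : R) : val (x * y) = val x * val y := by
  unfold val
  calc eps * (x * y) = (eps * eps) * (x * y) := by rw [eps_mul]
    _ = eps * x * (eps * y) := by ac_rfl

theorem mul_eq_val_mul (x : R) {f : R} (hf : f + f = f) : x * f = val x * f := by
  nth_rewrite 1 [← val_of_idem hf]
  unfold val; ac_rfl

theorem val_mono {x y : R} (h : x ≤ y) : val x ≤ val y := mul_le_mul'' eps h

theorem val_add_le (x y : R) : val x + val y ≤ val (x + y) := le_mul_add eps x y

theorem val_neg (x : R) : val (-x) = val x := by
  unfold val; rw [← neg_mul_eq]; exact neg_of_idem (val_idem x)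

theorem val_le_addE (x : R) : val x ≤ addE x := by
  have h := val_add_le x (-x)
  rw [val_neg, val_idem] at h
  rw [← val_of_idem (addE_idem x)]; exact h

theorem val_of_mul_idem {x : R} (hx : x * x = x) : val x = eps :=
  (idem_iff _).1 ⟨val_idem x, by rw [← val_mul, hx]⟩

theorem addE_eq (x : R) : addE x = val x * addE (mulE x) := by
  have h1 : addE (mulE x) ≤ val x⁻¹ * addE x := by
    rw [← mul_eq_val_mul _ (addE_idem x)]
    have := le_mul_add x⁻¹ x (-x)
    rw [← neg_mul_eq, mul_comm x⁻¹ x] at this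
    exact this
  have h2 : addE x ≤ val x * addE (mulE x) := by
    rw [← mul_eq_val_mul _ (addE_idem _)]
    have := le_mul_add x (mulE x) (-mulE x)
    rw [← neg_mul_eq, mul_mulE] at this
    exact this
  refine le_antisymm h2 ((mul_le_mul'' (val x) h1).trans (le_of_eq ?_))
  rw [← mul_assoc, ← val_mul]
  change val (mulE x) * _ = _
  rw [val_of_mul_idem (mulE_idem x), mul_comm, mul_eps_of_idem (addE_idem x)]

theorem addE_mul_of_mul_idem {x y : R} (hx : x * x = x) (hy : y * y = y) :
    addE (x * y) = addE x + addE y := by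
  have key : ∀ {x y : R}, x * x = x → addE (x * y) ≤ addE y := by
    intro x y hx
    have h := le_mul_add x y (-y)
    change _ ≤ x * addE y at h
    rw [← neg_mul_eq, mul_eq_val_mul _ (addE_idem y), val_of_mul_idem hx, mul_comm eps,
      mul_eps_of_idem (addE_idem y)] at h
    exact h
  refine le_antisymm (idem_le_add (addE_idem _) ?_ (key hx)) ?_
  · rw [mul_comm]; exact key hy
  · rw [← addE_add]; exact addE_add_le x y hx hy

theorem addE_mul (x y : R) : addE (x * y) = val x * addE y + val y * addE x := by
  rw [addE_eq (x * y), mulE_mul, addE_mul_of_mul_idem (mulE_idem x) (mulE_idem y), val_mul,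
    mul_add_idem _ (addE_idem _) (addE_idem _), addE_eq x, addE_eq y, add_comm]
  congr 1 <;> ac_rfl

theorem le_meet {u x y : R} (h : u ≤ x) (h' : u ≤ y) : u ≤ x + val (x + -y) := by
  have h1 : addE u ≤ val (x + -y) := by
    rw [← val_of_idem (addE_idem u)]
    exact val_mono (add_le_add' h (neg_le_neg' h'))
  calc u = u + addE u := (add_addE u).symm
    _ ≤ x + val (x + -y) := add_le_add' h h1

theorem meet_le_left (x y : R) : x + val (x + -y) ≤ x := add_le_self x (val_idem _)

theorem meet_mul_le (w x y : R) :
    w * x + val (w * x + -(w * y)) ≤ w * (x + val (x + -y)) := by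
  have h : val (w * x + -(w * y)) ≤ w * val (x + -y) := by
    rw [neg_mul_eq, mul_eq_val_mul w (val_idem _), ← val_mul]
    exact val_mono (le_mul_add _ _ _)
  exact (add_le_add' le_rfl h).trans (le_mul_add _ _ _)

end Basic

/-! ### The Abelian `l`-group `Λ = E⁺(R)` -/

section Lam

/-- `Λ = E⁺(R) = {x | x + x = x}`. -/
def Lam (R : Type*) [CrQsring R] : Type _ := {x : R // x + x = x}

variable {R : Type*} [CrQsring R]

instance : Coe (Lam R) R := ⟨Subtype.val⟩

theorem Lam.ext {a b : Lam R} (h : (a : R) = b) : a = b := Subtype.ext h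

/-- The group operation of `Λ` is induced by `•`, with neutral element `ε`. -/
instance : CommGroup (Lam R) where
  mul a b := ⟨(a : R) * b, mul_idem _ b.2⟩
  one := ⟨eps, eps_add⟩
  inv a := ⟨(a : R)⁻¹, inv_idem a.2⟩
  mul_assoc a b c := Lam.ext (mul_assoc (a : R) b c)
  mul_comm a b := Lam.ext (mul_comm (a : R) b)
  one_mul a := Lam.ext ((mul_comm (eps : R) a).trans (mul_eps_of_idem a.2))
  mul_one a := Lam.ext (mul_eps_of_idem a.2)
  inv_mul_cancel a := Lam.ext ((mul_comm (a : R)⁻¹ a).trans (mulE_of_idem a.2))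

instance : PartialOrder (Lam R) := PartialOrder.lift Subtype.val Subtype.val_injective

theorem Lam.coe_le {a b : Lam R} : (a : R) ≤ b ↔ a ≤ b := Iff.rfl

instance : IsOrderedMonoid (Lam R) where
  mul_le_mul_left _ _ h _ := mul_le_mul_both (R := R) h le_rfl

/-- The meet of `Λ`: `a ∧ b = a + b`. -/
def Lam.inf (a b : Lam R) : Lam R := ⟨(a : R) + b, add_idem_idem a.2 b.2⟩

theorem Lam.inf_le_left' (a b : Lam R) : Lam.inf a b ≤ a := add_le_self (a : R) b.2

theorem Lam.inf_le_right' (a b : Lam R) : Lam.inf a b ≤ b := by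
  change (a : R) + b ≤ b
  rw [add_comm]; exact add_le_self (b : R) a.2

/-- The lattice operations of `Λ`: `a ∧ b = a + b` and `a ∨ b = (a⁻¹ + b⁻¹)⁻¹`. -/
instance : Lattice (Lam R) where
  inf a b := Lam.inf a b
  sup a b := (Lam.inf a⁻¹ b⁻¹)⁻¹
  inf_le_left := Lam.inf_le_left'
  inf_le_right := Lam.inf_le_right'
  le_inf a _ _ h h' := idem_le_add (R := R) a.2 h h'
  le_sup_left _ _ := le_inv'.1 (Lam.inf_le_left' _ _)
  le_sup_right _ _ := le_inv'.1 (Lam.inf_le_right' _ _)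
  sup_le _ _ c h h' :=
    inv_le'.1 (idem_le_add (R := R) (c⁻¹).2 (inv_le_inv' h) (inv_le_inv' h'))

theorem Lam.coe_inf (a b : Lam R) : ((a ⊓ b : Lam R) : R) = (a : R) + b := rfl

/-- `e⁺ : R → Λ`. -/
def eL (x : R) : Lam R := ⟨addE x, addE_idem x⟩

/-- The quasivaluation `v : R → Λ`, `v(x) = ε • x`. -/
def vL (x : R) : Lam R := ⟨val x, val_idem x⟩

end Lam

/-! ### Directed and superrigid quasi-semirings -/

/-- `R` is directed: `ε ≤ x` for all `x ∈ E•`. -/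
class Directed (R : Type*) [CrQsring R] : Prop where
  eps_le : ∀ x : R, x * x = x → eps ≤ x

/-- `R` is superrigid: it is directed, and the (injective) map `e⁺ : E• → Λ₊` is surjective. -/
class Superrigid (R : Type*) [CrQsring R] : Prop extends Directed R where
  surj : ∀ α : Lam R, 1 ≤ α → ∃ x : R, x * x = x ∧ addE x = α

section DirectedLemmas

variable {R : Type*} [CrQsring R] [Directed R]

theorem val_le (x : R) : val x ≤ x := by
  have := mul_le_mul'' x (Directed.eps_le _ (mulE_idem x))
  rw [mul_mulE, mul_comm] at this
  exact this

theorem add_val_comm (x y : R) : x + val (x + -y) = y + val (x + -y) := by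
  have h : val (x + -y) = x + -y + val (x + -y) := by
    have := le_def.1 (val_le (x + -y))
    rwa [addE_of_idem (val_idem _)] at this
  have h2 : addE y + val (x + -y) = val (x + -y) := by
    have h3 := val_le_addE (x + -y)
    rw [le_def, addE_of_idem (val_idem _), addE_add, addE_neg] at h3
    rw [h3]
    calc addE y + (addE x + addE y + val (x + -y))
        = addE x + (addE y + addE y) + val (x + -y) := by ac_rfl
      _ = _ := by rw [addE_idem]
  symm
  calc y + val (x + -y) = y + (x + -y + val (x + -y)) := by rw [← h]
    _ = x + (addE y + val (x + -y)) := by unfold addE; ac_rfl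
    _ = x + val (x + -y) := by rw [h2]

theorem meet_le_right (x y : R) : x + val (x + -y) ≤ y := by
  rw [add_val_comm]; exact add_le_self y (val_idem _)

theorem mul_le_left_of_idem_idem {x y : R} (hx : x * x = x) (hy : y * y = y) : x * y ≤ x := by
  set z := x + val (x + -y) with hz
  have hxy : x * y * (x * y) = x * y := by
    calc x * y * (x * y) = (x * x) * (y * y) := by ac_rfl
      _ = x * y := by rw [hx, hy]
  have zx : z ≤ x := meet_le_left x y
  have zy : z ≤ y := meet_le_right x y
  have hzz_le : z * z ≤ x * y := mul_le_mul_both zx zy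
  have hzx : z * z ≤ z := by
    refine le_meet ?_ ?_
    · have := mul_le_mul_both zx zx; rwa [hx] at this
    · have := mul_le_mul_both zy zy; rwa [hy] at this
  have hve : addE z = val z * addE z := by
    rw [← mul_eq_val_mul z (addE_idem z)]
    refine le_antisymm ?_ ?_
    · have h := meet_mul_le (addE z) x y
      rw [mul_comm (addE z) x, mul_comm (addE z) y, mul_eq_val_mul x (addE_idem z),
        mul_eq_val_mul y (addE_idem z), val_of_mul_idem hx, val_of_mul_idem hy,
        mul_comm eps, mul_eps_of_idem (addE_idem z), ← hz] at h
      have e1 : addE z + val (addE z + -addE z) = addE z := by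
        rw [neg_of_idem (addE_idem z), addE_idem, val_of_idem (addE_idem z), addE_idem]
      rw [e1, mul_comm] at h
      exact h
    · refine (mul_le_mul_both zx le_rfl).trans (le_of_eq ?_)
      rw [mul_eq_val_mul x (addE_idem z), val_of_mul_idem hx, mul_comm,
        mul_eps_of_idem (addE_idem z)]
  have hzz : z * z = z := by
    refine eq_of_le_of_addE hzx ?_
    rw [addE_mul, ← hve, addE_idem]
  have h1 : z ≤ x * y := by rwa [hzz] at hzz_le
  have h2 : addE (x * y) ≤ addE z := by
    have e : x * y * z = x * y := by
      refine le_antisymm ?_ ?_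
      · calc x * y * z ≤ x * y * (x * y) := mul_le_mul'' _ h1
          _ = x * y := hxy
      · have h := meet_mul_le (x * y) x y
        have e1 : x * y * x = x * y := by
          calc x * y * x = (x * x) * y := by ac_rfl
            _ = x * y := by rw [hx]
        have e2 : x * y * y = x * y := by rw [mul_assoc, hy]
        rw [e1, e2, ← hz] at h
        refine le_trans (le_of_eq ?_) h
        change x * y = x * y + val (addE (x * y))
        rw [val_of_idem (addE_idem _), add_addE]
    rw [← e, addE_mul_of_mul_idem hxy hzz, add_comm]
    exact add_le_self _ (addE_idem _)
  rw [← eq_of_le_of_addE h1 h2]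
  exact zx

theorem mul_le_left_of_idem (x : R) {y : R} (hy : y * y = y) : x * y ≤ x := by
  calc x * y = x * (mulE x * y) := by rw [← mul_assoc, mul_mulE]
    _ ≤ x * mulE x := mul_le_mul'' x (mul_le_left_of_idem_idem (mulE_idem x) hy)
    _ = x := mul_mulE x

theorem le_of_addE_le {x y : R} (hx : x * x = x) (hy : y * y = y) (h : addE x ≤ addE y) :
    x ≤ y := by
  have h1 : x * y = x := by
    refine eq_of_le_of_addE (mul_le_left_of_idem_idem hx hy) ?_
    rw [addE_mul_of_mul_idem hx hy]
    exact idem_le_add (addE_idem x) le_rfl h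
  rw [← h1, mul_comm]
  exact mul_le_left_of_idem_idem hy hx

theorem vL_add (x : R) (α : Lam R) : vL (x + α) = vL x ⊓ α := by
  refine le_antisymm (le_inf ?_ ?_) ?_
  · exact val_mono (add_le_self x α.2)
  · refine le_trans (b := eL (x + (α : R))) (val_le_addE (x + (α : R))) ?_
    change addE (x + (α : R)) ≤ α
    rw [addE_add, addE_of_idem α.2, add_comm]
    exact add_le_self _ (addE_idem x)
  · change val x + (α : R) ≤ val (x + α)
    have := val_mono (add_le_add_right' (val_le x) (α : R))
    rwa [val_of_idem (add_idem_idem (val_idem x) α.2)] at this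

end DirectedLemmas

/-! ### The lattice-ordered extension of an Abelian `l`-group -/

section Hat

/-- The positive cone `Λ₊`. -/
abbrev Pos (Λ : Type*) [CommGroup Λ] [Lattice Λ] [IsOrderedMonoid Λ] : Submonoid Λ :=
  Submonoid.oneLE Λ

/-- `Λ^`: the maps `θ : Λ₊ → Λ` with `θ(α) = θ(β) ∧ α` for `α ≤ β`. -/
def LHat (Λ : Type*) [CommGroup Λ] [Lattice Λ] [IsOrderedMonoid Λ] : Type _ :=
  {θ : Pos Λ → Λ // ∀ α β : Pos Λ, α ≤ β → θ α = θ β ⊓ α}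

variable {Λ : Type*} [CommGroup Λ] [Lattice Λ] [IsOrderedMonoid Λ]

/-- The pointwise order of `Λ^`. -/
instance : PartialOrder (LHat Λ) := PartialOrder.lift Subtype.val Subtype.val_injective

/-- The embedding `Λ → Λ^`, `γ ↦ (α ↦ γ ∧ α)`. -/
def LHat.of (γ : Λ) : LHat Λ :=
  ⟨fun α => γ ⊓ α, fun α β h => by
    rw [inf_assoc, inf_eq_right.2 (show (α : Λ) ≤ β from h)]⟩

/-- `θ₋ = θ(ε)⁻¹ ∈ Λ₊`. -/
def LHat.negPart (θ : LHat Λ) : Pos Λ :=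
  ⟨(θ.1 1)⁻¹, by
    have h : θ.1 1 ≤ 1 := by rw [θ.2 1 1 le_rfl]; exact inf_le_right
    exact one_le_inv'.2 h⟩

end Hat

/-! ### The associated ring -/

/-- The underlying set of `B(R)`: maps `φ : Λ₊ → R` with `e⁺(φ(α)) = α` and `φ(α) ≤ φ(β)` for
`α ≤ β`. -/
@[ext]
structure AssocRing (R : Type*) [CrQsring R] where
  /-- The underlying map. -/
  toFun : Pos (Lam R) → R
  eL_apply : ∀ α, eL (toFun α) = α
  mono : ∀ α β, α ≤ β → toFun α ≤ toFun β

namespace AssocRing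

section Ring

variable {R : Type*} [CrQsring R]

instance : CoeFun (AssocRing R) fun _ => Pos (Lam R) → R := ⟨toFun⟩

/-- `v(φ(ε))⁻¹`, an element of `Λ₊`. -/
def shift (φ : AssocRing R) : Pos (Lam R) :=
  ⟨(vL (φ 1))⁻¹, by
    have h : vL (φ 1) ≤ 1 := by
      have h1 : vL (φ 1) ≤ eL (φ 1) := val_le_addE (φ 1)
      rwa [φ.eL_apply] at h1
    exact one_le_inv'.2 h⟩

theorem addE_apply (φ : AssocRing R) (α : Pos (Lam R)) : addE (φ α) = ((α : Lam R) : R) :=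
  congrArg Subtype.val (φ.eL_apply α)

theorem inv_shift_le (φ : AssocRing R) (α : Pos (Lam R)) :
    ((φ.shift : Lam R))⁻¹ ≤ vL (φ α) := by
  change ((vL (φ 1))⁻¹)⁻¹ ≤ _
  rw [inv_inv]
  exact val_mono (φ.mono 1 α α.2)

theorem eL_mul (x y : R) : eL (x * y) = vL x * eL y ⊓ vL y * eL x :=
  Lam.ext (addE_mul x y)

theorem eL_add (x y : R) : eL (x + y) = eL x ⊓ eL y := Lam.ext (addE_add x y)

theorem eL_coe (α : Lam R) : eL (α : R) = α := Lam.ext (addE_of_idem α.2)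

theorem eL_mono {x y : R} (h : x ≤ y) : eL x ≤ eL y := addE_mono h

theorem eq_of_le_of_eL {x y : R} (h : x ≤ y) (h' : eL x = eL y) : x = y :=
  eq_of_le_of_addE h (le_of_eq (congrArg Subtype.val h').symm)

theorem le_eL_mul (φ ψ : AssocRing R) (α β γ : Pos (Lam R)) (hβ : α * ψ.shift ≤ β)
    (hγ : α * φ.shift ≤ γ) : (α : Lam R) ≤ eL (φ β * ψ γ) := by
  rw [eL_mul, φ.eL_apply, ψ.eL_apply]
  refine le_inf ?_ ?_
  · calc (α : Lam R) = (φ.shift : Lam R)⁻¹ * ((α : Lam R) * (φ.shift : Lam R)) := by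
          rw [mul_comm (α : Lam R), inv_mul_cancel_left]
      _ ≤ _ := mul_le_mul' (φ.inv_shift_le β) hγ
  · calc (α : Lam R) = (ψ.shift : Lam R)⁻¹ * ((α : Lam R) * (ψ.shift : Lam R)) := by
          rw [mul_comm (α : Lam R), inv_mul_cancel_left]
      _ ≤ _ := mul_le_mul' (ψ.inv_shift_le γ) hβ

theorem eL_add_of_le {x : R} {α : Lam R} (h : α ≤ eL x) : eL (x + α) = α := by
  rw [eL_add, eL_coe]; exact inf_eq_right.2 h

theorem add_eq_of_le {x y : R} {α : Lam R} (h : α ≤ eL x) (hxy : x ≤ y) :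
    x + (α : R) = y + α :=
  eq_of_le_of_eL (add_le_add_right' hxy _)
    (by rw [eL_add_of_le h, eL_add_of_le (h.trans (eL_mono hxy))])

theorem apply_add (φ : AssocRing R) {α β : Pos (Lam R)} (h : α ≤ β) :
    φ β + ((α : Lam R) : R) = φ α := by
  have h1 : ((α : Lam R)) ≤ eL (φ α) := le_of_eq (φ.eL_apply α).symm
  rw [← add_eq_of_le h1 (φ.mono α β h)]
  have := add_addE (φ α)
  rwa [φ.addE_apply] at this

instance : Zero (AssocRing R) :=
  ⟨⟨fun α => ((α : Lam R) : R), fun α => eL_coe (α : Lam R), fun _ _ h => h⟩⟩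

instance : Add (AssocRing R) :=
  ⟨fun φ ψ => ⟨fun α => φ α + ψ α,
    fun α => by rw [eL_add, φ.eL_apply, ψ.eL_apply, inf_idem],
    fun α β h => add_le_add' (φ.mono α β h) (ψ.mono α β h)⟩⟩

instance : Neg (AssocRing R) :=
  ⟨fun φ => ⟨fun α => -φ α,
    fun α => (Lam.ext (addE_neg (φ α))).trans (φ.eL_apply α),
    fun α β h => neg_le_neg' (φ.mono α β h)⟩⟩

/-- `(φ · ψ)(α) = φ(α • v(ψ(ε))⁻¹) • ψ(α • v(φ(ε))⁻¹) + α`. -/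
instance : Mul (AssocRing R) :=
  ⟨fun φ ψ => ⟨fun α => φ (α * ψ.shift) * ψ (α * φ.shift) + ((α : Lam R) : R),
    fun α => eL_add_of_le (le_eL_mul φ ψ α _ _ le_rfl le_rfl),
    fun _ _ h => add_le_add' (mul_le_mul_both
      (φ.mono _ _ (mul_le_mul_left h _)) (ψ.mono _ _ (mul_le_mul_left h _))) h⟩⟩

theorem zero_apply (α : Pos (Lam R)) : (0 : AssocRing R) α = ((α : Lam R) : R) := rfl

theorem add_apply (φ ψ : AssocRing R) (α : Pos (Lam R)) : (φ + ψ) α = φ α + ψ α := rfl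

theorem neg_apply (φ : AssocRing R) (α : Pos (Lam R)) : (-φ) α = -φ α := rfl

theorem mul_def (φ ψ : AssocRing R) (α : Pos (Lam R)) :
    (φ * ψ) α = φ (α * ψ.shift) * ψ (α * φ.shift) + ((α : Lam R) : R) := rfl

theorem mul_apply (φ ψ : AssocRing R) {α β γ : Pos (Lam R)} (hβ : α * ψ.shift ≤ β)
    (hγ : α * φ.shift ≤ γ) : (φ * ψ) α = φ β * ψ γ + ((α : Lam R) : R) :=
  add_eq_of_le (le_eL_mul φ ψ α _ _ le_rfl le_rfl)
    (mul_le_mul_both (φ.mono _ _ hβ) (ψ.mono _ _ hγ))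

theorem pos_le_mul_left (α β : Pos (Lam R)) : α ≤ β * α := le_mul_of_one_le_left' β.2

theorem pos_le_mul_right (α β : Pos (Lam R)) : α ≤ α * β := le_mul_of_one_le_right' β.2

theorem mul_comm' (φ ψ : AssocRing R) : φ * ψ = ψ * φ := by
  refine AssocRing.ext (funext fun α => ?_)
  rw [mul_def, mul_def, mul_comm (φ _)]

theorem triple (φ ψ χ : AssocRing R) (α : Pos (Lam R)) :
    ∃ γ₀ : Pos (Lam R), ∀ γ, γ₀ ≤ γ → (φ * ψ * χ) α = φ γ * ψ γ * χ γ + ((α : Lam R) : R) := by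
  set β := α * χ.shift * (φ * ψ).shift with hβ
  refine ⟨β * ψ.shift * φ.shift, fun γ hγ => ?_⟩
  have h1 : α * χ.shift ≤ β := pos_le_mul_right _ _
  have h2 : α * (φ * ψ).shift ≤ β := by
    rw [hβ, mul_right_comm]; exact pos_le_mul_right _ _
  have g1 : β * ψ.shift ≤ γ := le_trans (pos_le_mul_right (β * ψ.shift) φ.shift) hγ
  have g2 : β * φ.shift ≤ γ := by
    refine le_trans ?_ hγ
    rw [mul_right_comm β ψ.shift φ.shift]; exact pos_le_mul_right _ _
  have g3 : β ≤ γ := le_trans (pos_le_mul_right β ψ.shift) g1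
  rw [mul_apply (φ * ψ) χ h1 h2]
  refine add_eq_of_le (le_eL_mul (φ * ψ) χ α β β h1 h2) (mul_le_mul_both ?_ (χ.mono _ _ g3))
  rw [mul_apply φ ψ g1 g2]
  exact add_le_self _ (β : Lam R).2

theorem mul_assoc' (φ ψ χ : AssocRing R) : φ * ψ * χ = φ * (ψ * χ) := by
  refine AssocRing.ext (funext fun α => ?_)
  obtain ⟨γ₁, h₁⟩ := triple φ ψ χ α
  obtain ⟨γ₂, h₂⟩ := triple ψ χ φ α
  rw [mul_comm' φ (ψ * χ), h₁ (γ₁ * γ₂) (pos_le_mul_right _ _),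
    h₂ (γ₁ * γ₂) (pos_le_mul_left _ _)]
  congr 1; ac_rfl

theorem mul_add' (φ ψ χ : AssocRing R) : φ * (ψ + χ) = φ * ψ + φ * χ := by
  refine AssocRing.ext (funext fun α => ?_)
  set s := φ.shift * (ψ + χ).shift * ψ.shift * χ.shift with hs
  have h0 : φ.shift ≤ s := by
    rw [hs, mul_assoc, mul_assoc]; exact pos_le_mul_right _ _
  have h1 : (ψ + χ).shift ≤ s := by
    rw [hs, mul_comm φ.shift, mul_assoc, mul_assoc]; exact pos_le_mul_right _ _
  have h2 : ψ.shift ≤ s := by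
    rw [hs, mul_right_comm]; exact pos_le_mul_left _ _
  have h3 : χ.shift ≤ s := pos_le_mul_left _ _
  rw [add_apply, mul_apply φ (ψ + χ) (mul_le_mul_right h1 α) (mul_le_mul_right h0 α),
    mul_apply φ ψ (mul_le_mul_right h2 α) (mul_le_mul_right h0 α),
    mul_apply φ χ (mul_le_mul_right h3 α) (mul_le_mul_right h0 α), add_apply]
  have e : φ (α * s) * ψ (α * s) + ((α : Lam R) : R) + (φ (α * s) * χ (α * s) + ((α : Lam R) : R))
      = φ (α * s) * ψ (α * s) + φ (α * s) * χ (α * s) + ((α : Lam R) : R) := by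
    rw [add_add_add_comm, (α : Lam R).2]
  rw [e]
  refine (add_eq_of_le ?_ (le_mul_add _ _ _)).symm
  rw [eL_add]
  exact le_inf (le_eL_mul φ ψ α _ _ (mul_le_mul_right h2 α) (mul_le_mul_right h0 α))
    (le_eL_mul φ χ α _ _ (mul_le_mul_right h3 α) (mul_le_mul_right h0 α))

instance : AddCommGroup (AssocRing R) where
  add_assoc φ ψ χ := AssocRing.ext (funext fun _ => add_assoc _ _ _)
  add_comm φ ψ := AssocRing.ext (funext fun _ => add_comm _ _)
  add_zero φ := AssocRing.ext (funext fun α => apply_add φ (le_refl α))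
  zero_add φ := AssocRing.ext (funext fun α => (add_comm _ _).trans (apply_add φ (le_refl α)))
  nsmul := nsmulRec
  zsmul := zsmulRec
  neg_add_cancel φ := AssocRing.ext (funext fun α => (add_comm _ _).trans (φ.addE_apply α))

end Ring

section Unital

variable {R : Type*} [CrQsring R] [Superrigid R]

/-- `1_α`, the unique element of `E•` with `e⁺(1_α) = α`. -/
noncomputable def oneAt (α : Pos (Lam R)) : R := (Superrigid.surj (α : Lam R) α.2).choose

theorem oneAt_mul (α : Pos (Lam R)) : oneAt α * oneAt α = oneAt α :=
  (Superrigid.surj (α : Lam R) α.2).choose_spec.1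

theorem addE_oneAt (α : Pos (Lam R)) : addE (oneAt α) = ((α : Lam R) : R) :=
  (Superrigid.surj (α : Lam R) α.2).choose_spec.2

noncomputable instance : One (AssocRing R) :=
  ⟨⟨oneAt, fun α => Lam.ext (addE_oneAt α), fun α β h =>
    le_of_addE_le (oneAt_mul α) (oneAt_mul β) (by rw [addE_oneAt, addE_oneAt]; exact h)⟩⟩

theorem one_apply (α : Pos (Lam R)) : (1 : AssocRing R) α = oneAt α := rfl

theorem mul_one' (φ : AssocRing R) : φ * 1 = φ := by
  refine AssocRing.ext (funext fun α => ?_)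
  have h : α ≤ α * (1 : AssocRing R).shift := pos_le_mul_right _ _
  rw [mul_def, add_eq_of_le (le_eL_mul φ 1 α _ _ le_rfl le_rfl)
    (mul_le_left_of_idem (φ (α * (1 : AssocRing R).shift)) (oneAt_mul (α * φ.shift))),
    apply_add φ h]

/-- The commutative ring `B(R)`. -/
noncomputable instance : CommRing (AssocRing R) where
  __ := (inferInstance : AddCommGroup (AssocRing R))
  mul_assoc := mul_assoc'
  mul_comm := mul_comm'
  mul_one := mul_one'
  one_mul φ := (mul_comm' 1 φ).trans (mul_one' φ)
  left_distrib := mul_add'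
  right_distrib φ ψ χ := by
    rw [mul_comm' (φ + ψ), mul_add', mul_comm' χ φ, mul_comm' χ ψ]
  zero_mul φ := by
    have h : 0 * φ + 0 * φ = 0 * φ := by
      rw [mul_comm' 0 φ, ← mul_add', add_zero]
    exact left_eq_add.1 h.symm
  mul_zero φ := by
    have h : φ * 0 + φ * 0 = φ * 0 := by rw [← mul_add', add_zero]
    exact left_eq_add.1 h.symm

/-- The `l`-valuation `w : B(R) → Λ^`, `w(φ) = v ∘ φ`. -/
def w (φ : AssocRing R) : LHat (Lam R) :=
  ⟨fun α => vL (φ α), fun α β h => by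
    change vL (φ α) = vL (φ β) ⊓ α
    rw [← apply_add φ h, vL_add]⟩

/-- `w(φ)₋ = v(φ(ε))⁻¹`. -/
theorem negPart_w (φ : AssocRing R) : (w φ).negPart = φ.shift := rfl

theorem one_le_w_iff {φ : AssocRing R} :
    LHat.of 1 ≤ w φ ↔ φ 1 = eps := by
  constructor
  · intro h
    have h1 : (1 : Lam R) ⊓ 1 ≤ vL (φ 1) := h 1
    rw [inf_idem] at h1
    have h2 : vL (φ 1) ≤ 1 := by
      have h3 : vL (φ 1) ≤ eL (φ 1) := val_le_addE (φ 1)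
      rwa [φ.eL_apply] at h3
    have h3 : val (φ 1) = eps := congrArg Subtype.val (le_antisymm h2 h1)
    rw [← h3]
    refine (eq_of_le_of_addE (val_le _) ?_).symm
    rw [φ.addE_apply, addE_of_idem (val_idem _), h3]
    exact le_rfl
  · intro h α
    change (1 : Lam R) ⊓ α ≤ vL (φ α)
    rw [inf_eq_left.2 (show (1 : Lam R) ≤ α from α.2)]
    have h1 := val_mono (φ.mono 1 α α.2)
    rw [h, val_of_idem eps_add] at h1
    exact h1

/-- The `l`-valuation ring `A = {φ | w(φ) ≥ ε}` of `w`. -/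
noncomputable def valRing (R : Type*) [CrQsring R] [Superrigid R] : Subring (AssocRing R) where
  carrier := {φ | LHat.of 1 ≤ w φ}
  mul_mem' {φ ψ} hφ hψ := by
    rw [Set.mem_ofPred_eq, one_le_w_iff] at *
    have e : ∀ χ : AssocRing R, χ 1 = eps → χ.shift = 1 := fun χ h => by
      refine Subtype.ext (?_ : (vL (χ 1))⁻¹ = 1)
      rw [inv_eq_one]
      exact Lam.ext ((congrArg val h).trans (val_of_idem eps_add))
    rw [mul_def, e φ hφ, e ψ hψ, mul_one, hφ, hψ, eps_mul]
    exact eps_add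
  one_mem' := by
    rw [Set.mem_ofPred_eq, one_le_w_iff, one_apply]
    exact (eq_of_le_of_addE (Directed.eps_le _ (oneAt_mul 1)) (by
      rw [addE_oneAt, addE_of_idem eps_add]; exact le_rfl)).symm
  add_mem' {φ ψ} hφ hψ := by
    rw [Set.mem_ofPred_eq, one_le_w_iff] at *
    rw [add_apply, hφ, hψ, eps_add]
  zero_mem' := by
    rw [Set.mem_ofPred_eq, one_le_w_iff]; rfl
  neg_mem' {φ} hφ := by
    rw [Set.mem_ofPred_eq, one_le_w_iff] at *
    rw [neg_apply, hφ, neg_of_idem eps_add]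

end Unital

end AssocRing

end CrQsring

/-! ### Prüfer extensions -/

/-- A commutative ring extension `A ⊆ B` is Prüfer if every finitely generated `A`-submodule `I`
of `B` with `I B = B` is `B`-invertible, i.e. `I J = A` for some `A`-submodule `J` of `B`. -/
def IsPruferExtension {B : Type*} [CommRing B] (A : Subring B) : Prop :=
  ∀ I : Submodule A B, I.FG → Ideal.span (I : Set B) = ⊤ → ∃ J : Submodule A B, I * J = 1

/-- `R` is a Prüfer cr-qsring: the associated extension `A ⊆ B` is Prüfer. -/
def CrQsring.IsPrufer (R : Type*) [CrQsring R] [CrQsring.Superrigid R] : Prop :=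
  IsPruferExtension (CrQsring.AssocRing.valRing R)

/-!
Write `A = valRing R` and `B = AssocRing R`. The proof has two independent halves.

*Ring theory.* For any subring `A` of a commutative ring `B`, the extension is Prüfer iff every
`x : B` has some `b ∈ A` with `x * b ∈ A` and `x * (1 - x * b) ∈ A`
(`isPruferExtension_iff`). Such a `b` is read off from an inverse of the module `A + A x`.
Conversely, relative to a prime `m` of `A` it yields either an `s ∉ m` with `s * x ∈ A` (take
`s = 1 - x * b`) or a `b ∈ A` with `b * x ∈ A \ m`. By induction every finite subset of `B` has a
common denominator that is optimal at `m` (`exists_denominator`). If `I` is generated by the `xᵢ`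
and `∑ cᵢ xᵢ = 1`, then such a denominator of the products `cᵢ xⱼ` shows that `I * (A : I)` is
not contained in `m`; hence `I * (A : I)` is all of `A`.

*Quasi-semirings.* Let `γ = v(φ(ε))⁻¹`. Since the positive and negative parts of an element of an
`l`-group are disjoint, `v(φ(γ)) = γ⁻¹` holds exactly (`vL_apply_shift`). As `v` is multiplicative
on `R`, multiplication by `φ` shifts valuations precisely by `γ⁻¹` up to level `γ`, so that
`φ * (1 - φ * ψ) ∈ A` says that `φ * ψ` is congruent to `1` modulo `γ`, and this in turn says that
`ψ` is a quasi-inverse of `φ(γ)` modulo `γ²` (`le_inv_iff`).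
-/

/-! ### Prüfer extensions -/

section PruferExtension

variable {B : Type*} [CommRing B] {A : Subring B}

/-- A finite subset `T` of `B` containing `1` has a common denominator `c ∈ A` such that `c T` is
not contained in a given prime `m` of `A`. -/
theorem exists_denominator
    (h : ∀ x : B, ∃ b ∈ A, x * b ∈ A ∧ x * (1 - x * b) ∈ A)
    (m : Ideal A) [m.IsPrime] (T : Finset B) :
    ∃ c : A, (∀ y ∈ T, (c : B) * y ∈ A) ∧
      ∃ y, (y = 1 ∨ y ∈ T) ∧ ∃ t : A, (t : B) = c * y ∧ t ∉ m := by
  classical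
  induction T using Finset.induction_on with
  | empty => exact ⟨1, by simp, 1, .inl rfl, 1, by simp, m.one_notMem⟩
  | insert y T _ ih =>
    obtain ⟨c, hc, z, hz, t, ht, htm⟩ := ih
    obtain ⟨b, hb, hyb, hyyb⟩ := h (c * y)
    by_cases hm : (⟨c * y * b, hyb⟩ : A) ∈ m
    · -- `s = 1 - c y b` is a denominator of `c y` outside `m`
      obtain ⟨s, hs⟩ : ∃ s : A, s = 1 - ⟨c * y * b, hyb⟩ := ⟨_, rfl⟩
      have hsm : s ∉ m := fun hsm => m.one_notMem (by
        have := m.add_mem hsm hm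
        rwa [hs, sub_add_cancel] at this)
      have hsB : (s : B) = 1 - c * y * b := by rw [hs]; rfl
      refine ⟨s * c, ?_, z, ?_, s * t, ?_, ‹m.IsPrime›.mul_notMem hsm htm⟩
      · intro u hu
        rcases Finset.mem_insert.1 hu with rfl | hu
        · convert hyyb using 1
          push_cast
          rw [hsB]; ring
        · have := A.mul_mem s.2 (hc u hu)
          rwa [← mul_assoc] at this
      · exact hz.imp id (Finset.mem_insert_of_mem ·)
      · push_cast
        rw [ht, mul_assoc]
    · refine ⟨⟨b, hb⟩ * c, ?_, y, .inr (Finset.mem_insert_self y T), ⟨c * y * b, hyb⟩, ?_, hm⟩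
      · intro u hu
        rcases Finset.mem_insert.1 hu with rfl | hu
        · convert hyb using 1
          push_cast
          ring
        · have := A.mul_mem hb (hc u hu)
          rwa [← mul_assoc] at this
      · push_cast
        ring

/-- From `(A + A x) J = A` write `1 = a + x b` with `a, b ∈ J`; then `J` and `x J` lie in `A`, and
`x (1 - x b) = x a`. -/
theorem IsPruferExtension.exists_mem (hA : IsPruferExtension A) (x : B) :
    ∃ b ∈ A, x * b ∈ A ∧ x * (1 - x * b) ∈ A := by
  have h1 : (1 : B) ∈ Submodule.span A {1, x} := Submodule.subset_span (by simp)
  have hx : x ∈ Submodule.span A {1, x} := Submodule.subset_span (by simp)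
  obtain ⟨J, hJ⟩ := hA (Submodule.span A {1, x})
    (Submodule.fg_span (Set.toFinite _))
    ((Ideal.eq_top_iff_one _).2 (Ideal.subset_span h1))
  have hmem : ∀ y ∈ Submodule.span A {1, x}, ∀ z ∈ J, y * z ∈ A := by
    intro y hy z hz
    have := Submodule.mul_mem_mul hy hz
    rw [hJ, Submodule.mem_one] at this
    obtain ⟨a, ha⟩ := this
    rw [← ha]
    exact a.2
  have h : (1 : B) ∈ Submodule.span A {1, x} * J := by
    rw [hJ]; exact Submodule.one_le.1 le_rfl
  rw [Submodule.span_insert, Submodule.sup_mul, Submodule.mem_sup] at h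
  obtain ⟨a, ha, y, hy, hay⟩ := h
  obtain ⟨a', ha', rfl⟩ := Submodule.mem_span_singleton_mul.1 ha
  obtain ⟨b, hb, rfl⟩ := Submodule.mem_span_singleton_mul.1 hy
  refine ⟨b, by simpa using hmem 1 h1 b hb, hmem x hx b hb, ?_⟩
  rw [← hay, one_mul, add_sub_cancel_right]
  exact hmem x hx a' ha'

/-- Elementwise criterion: it suffices to invert the modules `A + A x`. -/
theorem isPruferExtension_iff :
    IsPruferExtension A ↔ ∀ x : B, ∃ b ∈ A, x * b ∈ A ∧ x * (1 - x * b) ∈ A := by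
  classical
  refine ⟨fun h => h.exists_mem, fun h I hI hIB => ⟨1 / I, ?_⟩⟩
  refine le_antisymm Submodule.mul_one_div_le_one ?_
  rw [Submodule.one_le]
  obtain ⟨S, rfl⟩ := hI
  have hS : (1 : B) ∈ Submodule.span B (S : Set B) := by
    have h1 : (1 : B) ∈ Ideal.span ((Submodule.span A (S : Set B) : Submodule A B) : Set B) := by
      rw [hIB]; exact Submodule.mem_top
    rwa [Ideal.span, Submodule.span_span_of_tower] at h1
  obtain ⟨f, -, hf⟩ := Submodule.mem_span_finset.1 hS
  by_contra hn
  set I := Submodule.span A (S : Set B)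
  -- the ideal `I (A : I)` of `A`
  set K : Ideal A := (I * (1 / I)).comap (Algebra.linearMap A B) with hK
  have hK1 : K ≠ ⊤ := fun h => hn (by
    have h1 : (1 : A) ∈ K := by rw [h]; exact Submodule.mem_top
    simpa [hK] using h1)
  obtain ⟨m, hm, hKm⟩ := Ideal.exists_le_maximal K hK1
  have hmp := hm.isPrime
  obtain ⟨c, hc, y, hy, t, ht, htm⟩ :=
    exists_denominator h m ((S ×ˢ S).image fun p => f p.1 * p.2)
  have hcS : ∀ i ∈ S, ∀ j ∈ S, (c : B) * (f i * j) ∈ A := fun i hi j hj =>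
    hc _ (Finset.mem_image.2 ⟨(i, j), Finset.mem_product.2 ⟨hi, hj⟩, rfl⟩)
  -- `c cᵢ` lies in `(A : I)`, so all the products `c cᵢ xⱼ` lie in `I (A : I) ⊆ m`
  have hcm : ∀ i ∈ S, ∀ j ∈ S, ∀ u : A, (u : B) = c * (f i * j) → u ∈ m := by
    intro i hi j hj u hu
    refine hKm ?_
    rw [hK, Submodule.mem_comap]
    change (u : B) ∈ _
    rw [show (u : B) = j * (c * f i) by rw [hu]; ring]
    refine Submodule.mul_mem_mul (Submodule.subset_span hj) ?_
    rw [Submodule.mem_div_iff_forall_mul_mem]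
    intro z hz
    induction hz using Submodule.span_induction with
    | mem z hz =>
      rw [mul_assoc]
      exact Submodule.mem_one.2 ⟨⟨_, hcS i hi z hz⟩, rfl⟩
    | zero => simp
    | add z z' _ _ hz hz' => rw [mul_add]; exact add_mem hz hz'
    | smul a z _ hz => rw [mul_smul_comm]; exact Submodule.smul_mem _ _ hz
  rcases hy with rfl | hy
  · refine htm ?_
    have : t = ∑ i ∈ S.attach, (⟨_, hcS i i.2 i i.2⟩ : A) := by
      refine Subtype.ext ?_
      rw [ht, AddSubmonoidClass.coe_finsetSum, ← hf, Finset.mul_sum, ← Finset.sum_attach]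
      rfl
    rw [this]
    exact Ideal.sum_mem _ fun i _ => hcm i i.2 i i.2 _ rfl
  · obtain ⟨p, hp, rfl⟩ := Finset.mem_image.1 hy
    obtain ⟨hp1, hp2⟩ := Finset.mem_product.1 hp
    exact htm (hcm _ hp1 _ hp2 t ht)

end PruferExtension

/-! ### Quasi-inverses modulo `γ²` -/

namespace CrQsring

variable {R : Type*} [CrQsring R]

theorem vL_mul (x y : R) : vL (x * y) = vL x * vL y := Lam.ext (val_mul x y)

theorem vL_mono {x y : R} (h : x ≤ y) : vL x ≤ vL y := val_mono h

theorem vL_coe (α : Lam R) : vL (α : R) = α := Lam.ext (val_of_idem α.2)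

theorem vL_le_eL (x : R) : vL x ≤ eL x := val_le_addE x

theorem vL_of_mul_idem {x : R} (hx : x * x = x) : vL x = 1 := Lam.ext (val_of_mul_idem hx)

theorem vL_inv (x : R) : vL x⁻¹ = (vL x)⁻¹ := by
  rw [← mul_eq_one_iff_eq_inv', ← vL_mul]
  exact vL_of_mul_idem (mulE_idem x)

theorem eL_eq (x : R) : eL x = vL x * eL (mulE x) := Lam.ext (addE_eq x)

namespace AssocRing

/-- Two lower bounds of `z` with the same `e⁺` coincide. -/
theorem eq_of_le_of_le {x y z : R} (hx : x ≤ z) (hy : y ≤ z) (h : eL x = eL y) : x = y := by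
  rw [le_def.1 hx, le_def.1 hy, show addE x = addE y from congrArg Subtype.val h]

variable [Superrigid R]

theorem vL_apply_one (φ : AssocRing R) (α : Pos (Lam R)) : vL (φ 1) = vL (φ α) ⊓ 1 :=
  (w φ).2 1 α α.2

theorem mem_valRing_of_one_le {φ : AssocRing R} (α : Pos (Lam R)) (h : 1 ≤ vL (φ α)) :
    φ ∈ valRing R := by
  change LHat.of 1 ≤ w φ
  intro β
  change 1 ⊓ (β : Lam R) ≤ vL (φ β)
  refine inf_le_left.trans ?_
  rw [← inf_eq_right.2 h, ← vL_apply_one]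
  exact vL_mono (φ.mono 1 β β.2)

theorem apply_one_of_mem {φ : AssocRing R} (h : φ ∈ valRing R) : φ 1 = eps :=
  one_le_w_iff.1 h

theorem shift_of_mem {φ : AssocRing R} (h : φ ∈ valRing R) : φ.shift = 1 := by
  refine Subtype.ext ?_
  change (vL (φ 1))⁻¹ = 1
  rw [apply_one_of_mem h, inv_eq_one]
  exact vL_of_mul_idem eps_mul

theorem one_le_vL_of_mem {φ : AssocRing R} (h : φ ∈ valRing R) (α : Pos (Lam R)) :
    1 ≤ vL (φ α) := by
  rw [← vL_of_mul_idem (eps_mul (R := R)), ← apply_one_of_mem h]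
  exact vL_mono (φ.mono 1 α α.2)

/-- At the level `γ = v(φ(ε))⁻¹` the value of `φ` is exactly `γ⁻¹`: the positive part of
`v(φ(γ))` is at most `γ` and disjoint from the negative part `γ`. -/
theorem vL_apply_shift (φ : AssocRing R) : vL (φ φ.shift) = (φ.shift : Lam R)⁻¹ := by
  set γ := (φ.shift : Lam R)
  set a := vL (φ φ.shift)
  have h1 : a ⊓ 1 = γ⁻¹ := by
    rw [← vL_apply_one]; exact (inv_inv _).symm
  have h2 : a ≤ γ := (vL_le_eL _).trans (le_of_eq (φ.eL_apply _))
  have h3 : a ⊔ 1 = a * γ := by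
    have := inf_mul_sup a 1
    rw [h1, mul_one, inv_mul_eq_iff_eq_mul] at this
    rw [this, mul_comm]
  have h4 : (a ⊔ 1) ⊓ γ = 1 := by
    rw [h3]
    nth_rewrite 2 [← one_mul γ]
    rw [← inf_mul, h1, inv_mul_cancel]
  rw [inf_eq_left.2 (sup_le h2 φ.shift.2)] at h4
  rw [h4] at h3
  exact eq_inv_of_mul_eq_one_left h3.symm

/-- The idempotent `φ(γ) • φ(γ)⁻¹` is `1` modulo `γ²`. -/
theorem eL_mulE_apply_shift (φ : AssocRing R) :
    eL (mulE (φ φ.shift)) = (φ.shift : Lam R) * φ.shift := by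
  have h := eL_eq (φ φ.shift)
  rw [φ.eL_apply, vL_apply_shift] at h
  nth_rewrite 1 [h]
  rw [mul_comm, mul_inv_cancel_left]

theorem mul_apply_shift (φ : AssocRing R) {ψ : AssocRing R} (hψ : ψ ∈ valRing R) :
    (φ * ψ) φ.shift = φ φ.shift * ψ (φ.shift * φ.shift) + ((φ.shift : Lam R) : R) :=
  mul_apply φ ψ (by rw [shift_of_mem hψ, mul_one]) le_rfl

theorem vL_mul_apply_one (φ : AssocRing R) {χ : AssocRing R} (hχ : χ ∈ valRing R) :
    vL ((φ * χ) 1) = (φ.shift : Lam R)⁻¹ * vL (χ φ.shift) ⊓ 1 := by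
  have h := mul_apply φ χ (α := 1) (β := φ.shift) (γ := φ.shift)
    (by rw [shift_of_mem hχ, mul_one]; exact φ.shift.2) (by rw [one_mul])
  rw [h, vL_add, vL_mul, vL_apply_shift]
  rfl

theorem sub_apply (φ ψ : AssocRing R) (α : Pos (Lam R)) : (φ - ψ) α = φ α + -ψ α := by
  rw [sub_eq_add_neg]; rfl

/-- An element `χ ∈ A` satisfies `φ χ ∈ A` iff it vanishes modulo `γ = v(φ(ε))⁻¹`. -/
theorem mul_mem_valRing_iff (φ : AssocRing R) {χ : AssocRing R} (hχ : χ ∈ valRing R) :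
    φ * χ ∈ valRing R ↔ χ φ.shift = ((φ.shift : Lam R) : R) := by
  constructor
  · intro h
    have h1 := vL_mul_apply_one φ hχ
    have h2 := one_le_vL_of_mem h 1
    rw [h1] at h2
    have h3 : (φ.shift : Lam R) ≤ vL (χ φ.shift) := by
      have := h2.trans inf_le_left
      rwa [le_inv_mul_iff_mul_le, mul_one] at this
    have h4 : vL (χ φ.shift) = φ.shift :=
      le_antisymm ((vL_le_eL _).trans (le_of_eq (χ.eL_apply _))) h3
    rw [← show val (χ φ.shift) = ((φ.shift : Lam R) : R) from congrArg Subtype.val h4]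
    refine (eq_of_le_of_eL (val_le _) ?_).symm
    rw [χ.eL_apply, ← h4]
    exact eL_coe (vL (χ φ.shift))
  · intro h
    refine mem_valRing_of_one_le 1 ?_
    rw [vL_mul_apply_one φ hχ, h, vL_coe, inv_mul_cancel, inf_idem]

/-- For `ψ ∈ A`, inverting `φ(γ)` modulo `γ²` amounts to `φ ψ` being `1` modulo `γ`. -/
theorem apply_le_inv_iff (φ : AssocRing R) {ψ : AssocRing R} (hψ : ψ ∈ valRing R) :
    ψ (φ.shift * φ.shift) ≤ (φ φ.shift)⁻¹ ↔ (φ * ψ) φ.shift = oneAt φ.shift := by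
  have hp : (φ.shift : Lam R) * 1 ≤ φ.shift * vL (ψ (φ.shift * φ.shift)) :=
    mul_le_mul_right (one_le_vL_of_mem hψ _) _
  constructor
  · intro h
    refine eq_of_le_of_le (z := mulE (φ φ.shift)) ?_ ?_ ?_
    · rw [mul_apply_shift φ hψ]
      exact (add_le_self _ (φ.shift : Lam R).2).trans (mul_le_mul'' _ h)
    · refine le_of_addE_le (oneAt_mul _) (mulE_idem _) ?_
      rw [addE_oneAt]
      change (φ.shift : Lam R) ≤ eL (mulE (φ φ.shift))
      rw [eL_mulE_apply_shift]
      exact le_mul_of_one_le_right' φ.shift.2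
    · rw [eL_apply]
      exact ((1 : AssocRing R).eL_apply φ.shift).symm
  · intro h
    -- both sides have `e⁺ = γ`, so no further truncation takes place
    have h1 : oneAt φ.shift = φ φ.shift * ψ (φ.shift * φ.shift) := by
      rw [← h, mul_apply_shift φ hψ]
      refine eq_of_le_of_eL (add_le_self _ (φ.shift : Lam R).2) ?_
      have h2 : eL (φ φ.shift * ψ (φ.shift * φ.shift)) = φ.shift := by
        rw [eL_mul, φ.eL_apply, ψ.eL_apply, vL_apply_shift, Submonoid.coe_mul,
          inv_mul_cancel_left, mul_comm (vL _)]
        rw [mul_one] at hp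
        exact inf_eq_left.2 hp
      rw [eL_add, h2, eL_coe, inf_idem]
    have h3 : ψ (φ.shift * φ.shift) * mulE (φ φ.shift) = ψ (φ.shift * φ.shift) := by
      refine eq_of_le_of_eL (mul_le_left_of_idem _ (mulE_idem _)) ?_
      rw [eL_mul, vL_of_mul_idem (mulE_idem _), eL_mulE_apply_shift, one_mul, ψ.eL_apply]
      exact inf_eq_right.2 (le_mul_of_one_le_left' (one_le_vL_of_mem hψ _))
    calc ψ (φ.shift * φ.shift)
        = φ φ.shift * ψ (φ.shift * φ.shift) * (φ φ.shift)⁻¹ := by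
          rw [← h3]
          nth_rewrite 2 [h3]
          unfold mulE; ac_rfl
      _ = (φ φ.shift)⁻¹ * oneAt φ.shift := by rw [← h1, mul_comm]
      _ ≤ (φ φ.shift)⁻¹ := mul_le_left_of_idem _ (oneAt_mul _)

theorem mem_valRing_of_apply_le_inv {φ ψ : AssocRing R}
    (h : ψ (φ.shift * φ.shift) ≤ (φ φ.shift)⁻¹) : ψ ∈ valRing R := by
  refine mem_valRing_of_one_le (φ.shift * φ.shift) ?_
  rw [le_def.1 h, addE_apply, vL_add, vL_inv, vL_apply_shift, inv_inv]
  exact le_inf φ.shift.2 (φ.shift * φ.shift).2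

/-- The quasi-inverses of `φ(γ)` modulo `γ²` are exactly the witnesses `b = ψ` for `x = φ` in
`isPruferExtension_iff`. -/
theorem le_inv_iff (φ ψ : AssocRing R) :
    ψ (φ.shift * φ.shift) ≤ (φ φ.shift)⁻¹ ↔
      ψ ∈ valRing R ∧ φ * ψ ∈ valRing R ∧ φ * (1 - φ * ψ) ∈ valRing R := by
  constructor
  · intro h
    have hψ := mem_valRing_of_apply_le_inv h
    have h1 := (apply_le_inv_iff φ hψ).1 h
    have h2 : φ * ψ ∈ valRing R :=
      mem_valRing_of_one_le φ.shift (by rw [h1, vL_of_mul_idem (oneAt_mul _)])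
    refine ⟨hψ, h2, (mul_mem_valRing_iff φ (sub_mem (one_mem _) h2)).2 ?_⟩
    rw [sub_apply, h1, one_apply]
    exact addE_oneAt _
  · rintro ⟨hψ, h2, h3⟩
    refine (apply_le_inv_iff φ hψ).2 ?_
    have h4 := (mul_mem_valRing_iff φ (sub_mem (one_mem _) h2)).1 h3
    calc (φ * ψ) φ.shift = (1 - (1 - φ * ψ)) φ.shift := by rw [sub_sub_cancel]
      _ = oneAt φ.shift := by
        rw [sub_apply, h4, neg_of_idem (φ.shift : Lam R).2]
        exact (1 : AssocRing R).apply_add le_rfl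

end AssocRing

end CrQsring

theorem corollary6p7 (R : Type*) [CrQsring R] [CrQsring.Superrigid R] :
    CrQsring.IsPrufer R ↔
      ∀ φ : CrQsring.AssocRing R, ∃ ψ : CrQsring.AssocRing R,
        ψ ((CrQsring.AssocRing.w φ).negPart * (CrQsring.AssocRing.w φ).negPart) ≤
          (φ (CrQsring.AssocRing.w φ).negPart)⁻¹ := by
  simp only [CrQsring.AssocRing.negPart_w, CrQsring.AssocRing.le_inv_iff]
  exact isPruferExtension_iff
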